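/- Write $2^{<\omega}$ for the set of finite binary strings, $|\tau|$ for the length of $\tau\in 2^{<\omega}$, and $\#_0(\tau)$, $\#_1(\tau)$ for the numbers of $0$'s and $1$'s in $\tau$. For $j\ge 1$ put $\ell_j(\tau)=\#_0(\tau)+j\,\#_1(\tau)$. A prefix-free machine is a partial computable function $M:2^{<\omega}\to 2^{<\omega}$ whose domain contains no two distinct strings one of which is an initial segment of the other. A prefix-free machine $U$ is universal if for every prefix-free machine $M$ there is a string $\rho_M$ such that $U(\rho_M{}^\smallfrown\sigma)=M(\sigma)$ for all $\sigma\in\mathrm{dom}(M)$. Fix a universal prefix-free machine $U$ and let \[ K(\sigma)=\min\{|\tau| : U(\tau)=\sigma\},\qquad K^{(k)}(\sigma)=\min\{\ell_k(\tau) : U(\tau)=\sigma\}. \] For $X\in 2^\omega$ let $X\upharpoonright n$ be the string of the first $n$ bits of $X$. For $k,j\geq 1$, $X$ is called $(k,j)$-incompressible if there is a constant $c$ such that $K^{(k)}(X\upharpoonright n)\ge \ell_j(X\upharpoonright n)-c$ for all $n$. **Theorem.** Let $k\ge 1$ be an integer, let $p_k$ be the unique $x\in(0,1)$ with $x^k+x-1=0$,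 and let $\varepsilon\in(0,1-p_k)$. Let $X\in 2^\omega$, and suppose that there is a constant $c$ such that for all $n\in\mathbb{N}$ \[ K(X\upharpoonright n)\ \ge\ \frac{n}{1+(k-1)(1-p_k-\varepsilon)}-c . \] Then $X$ is $(k,1)$-incompressible, i.e. there is a constant $c'$ such that $K^{(k)}(X\upharpoonright n)\ge n-c'$ for all $n\in\mathbb{N}$. -/

import Mathlib

/-- A set of finite binary strings is prefix-free if no element of it properly extends another. -/
def IsPrefixFree (S : Set (List Bool)) : Prop :=
  ∀ σ ∈ S, ∀ τ ∈ S, σ <+: τ → σ = τ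

/-- A prefix-free machine: a partial computable function from binary strings to binary strings
(`false` is the digit 0, `true` is the digit 1) whose domain is prefix-free. -/
def IsPrefixFreeMachine (M : List Bool →. List Bool) : Prop :=
  Partrec M ∧ IsPrefixFree M.Dom

/-- A universal prefix-free machine: a prefix-free machine `U` that simulates every prefix-free
machine `M` by means of a fixed string `ρ` prepended to the inputs of `M`. -/
def IsUniversalPrefixFreeMachine (U : List Bool →. List Bool) : Prop :=
  IsPrefixFreeMachine U ∧
    ∀ M : List Bool →. List Bool, IsPrefixFreeMachine M →
      ∃ ρ : List Bool, ∀ σ ∈ M.Dom, U (ρ ++ σ) = M σ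

/-- The complexity of `σ` relative to the machine `M` and the length function `ℓ`: the least
value of `ℓ` on an input on which `M` halts with output `σ`. It is only meaningful if there is
such an input; for a universal prefix-free machine there always is one
(`IsUniversalPrefixFreeMachine.exists_description`). -/
noncomputable def lengthComplexity (ℓ : List Bool → ℕ) (M : List Bool →. List Bool)
    (σ : List Bool) : ℕ :=
  sInf {m : ℕ | ∃ τ : List Bool, σ ∈ M τ ∧ ℓ τ = m}

theorem IsUniversalPrefixFreeMachine.exists_description {U : List Bool →. List Bool}
    (hU : IsUniversalPrefixFreeMachine U) (σ : List Bool) : ∃ τ : List Bool, σ ∈ U τ := by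
  let M : List Bool →. List Bool := fun τ => ((if τ = [] then some σ else none : Option _) : Part _)
  have hM : IsPrefixFreeMachine M := by
    refine ⟨?_, ?_⟩
    · refine Computable.ofOption ?_
      refine Primrec.to_comp ?_
      exact Primrec.ite (Primrec.eq.comp Primrec.id (Primrec.const [])) (Primrec.const _)
        (Primrec.const _)
    · have key : ∀ τ ∈ M.Dom, τ = [] := by
        intro τ hτ
        by_contra h
        simp [M, PFun.Dom, h] at hτ
      intro σ₁ h₁ σ₂ h₂ _
      rw [key _ h₁, key _ h₂]
  obtain ⟨ρ, hρ⟩ := hU.2 M hM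
  refine ⟨ρ ++ [], ?_⟩
  rw [hρ [] (by simp [M, PFun.Dom])]
  simp [M]

/-- Prefix-free Kolmogorov complexity `K`, relative to the machine `U`. -/
noncomputable def kolmogorov (U : List Bool →. List Bool) (σ : List Bool) : ℕ :=
  lengthComplexity List.length U σ

/-- The `k`-length of a binary string: each 0 has length `1`, each 1 has length `k`. -/
def kLength (k : ℕ) (σ : List Bool) : ℕ :=
  σ.count false + k * σ.count true

/-- The `k`-complexity `K^(k)`, relative to the machine `U`. -/
noncomputable def kComplexity (k : ℕ) (U : List Bool →. List Bool) (σ : List Bool) : ℕ :=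
  lengthComplexity (kLength k) U σ

/-- The string of the first `n` bits of an infinite binary sequence. -/
def initSeg (X : ℕ → Bool) (n : ℕ) : List Bool :=
  List.ofFn fun i : Fin n => X i

/-- `X` is `(k,j)`-incompressible: `K^(k)` of the initial segments of `X` is at least their
`j`-length, up to an additive constant. -/
def IsKJIncompressible (U : List Bool →. List Bool) (k j : ℕ) (X : ℕ → Bool) : Prop :=
  ∃ c : ℝ, ∀ n : ℕ,
    (kLength j (initSeg X n) : ℝ) - c ≤ (kComplexity k U (initSeg X n) : ℝ)

theorem kLength_one_initSeg (X : ℕ → Bool) (n : ℕ) : kLength 1 (initSeg X n) = n := by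
  simp [kLength, initSeg]

theorem existsUnique_pRoot (k : ℕ) (hk : 1 ≤ k) :
    ∃! x : ℝ, x ∈ Set.Ioo (0 : ℝ) 1 ∧ x ^ k + x - 1 = 0 := by
  have hcont : ContinuousOn (fun x : ℝ => x ^ k + x - 1) (Set.Icc 0 1) := by fun_prop
  have hmem : (0 : ℝ) ∈ Set.Ioo ((0 : ℝ) ^ k + 0 - 1) ((1 : ℝ) ^ k + 1 - 1) := by
    simp [zero_pow (by omega : k ≠ 0)]
  obtain ⟨c, hc, hc0⟩ := intermediate_value_Ioo (zero_le_one' ℝ) hcont hmem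
  refine ⟨c, ⟨hc, hc0⟩, ?_⟩
  rintro y ⟨hy, hy0⟩
  simp only at hc0
  rcases lt_trichotomy y c with h | h | h
  · have := pow_le_pow_left₀ hy.1.le h.le k
    linarith
  · exact h
  · have := pow_le_pow_left₀ hc.1.le h.le k
    linarith

/-- `p_k`, the unique root of `x ^ k + x - 1` in the open unit interval. -/
noncomputable def pRoot (k : ℕ) (hk : 1 ≤ k) : ℝ :=
  (existsUnique_pRoot k hk).choose

/-! If x = 2^(-a) satisfies x + x^k < 1, give each program τ the weight x^(ℓ_k(τ)). The words of
length m then have total weight (x + x^k)^m, which tends to 0. This slack pays for rounding code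
lengths to integers, so the converse of Kraft's inequality yields a computable block code of length
at most a ℓ_k(τ) + O(1). Re-encoding the programs of U by it gives K ≤ a K^(k) + O(1)
(`IsUniversalPrefixFreeMachine.exists_kolmogorov_le`). Take a = 1/d, with d the denominator in the
hypothesis, and k > 1. Since 1 - p_k = p_k^k, the bound of one bit on the entropy of p_k reads
2^(-1/D) ≤ p_k for D = 1 + (k-1)(1-p_k). As d < D, x < p_k and so x + x^k < 1. Multiplying n/d - c ≤
K ≤ K^(k)/d + C by d finishes the proof. -/

/-- A prefix code on binary strings: no code word is an initial segment of the code word of a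
different string. -/
def IsPrefixCode (E : List Bool → List Bool) : Prop :=
  ∀ σ τ, E σ <+: E τ → σ = τ

/-! ### Counting binary words, and the converse of Kraft's inequality -/

/-- The finite set of binary strings of length `m`. -/
def binaryWords : ℕ → Finset (List Bool)
  | 0 => {[]}
  | m + 1 => (binaryWords m).image (List.cons false) ∪ (binaryWords m).image (List.cons true)

theorem mem_binaryWords {m : ℕ} {w : List Bool} : w ∈ binaryWords m ↔ w.length = m := by
  induction m generalizing w with
  | zero => simp [binaryWords]
  | succ m ih =>
    rcases w with _ | ⟨b, w⟩
    · simp [binaryWords]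
    · cases b <;> simp [binaryWords, ih]

theorem sum_binaryWords_succ (m : ℕ) (f : List Bool → ℝ) :
    ∑ w ∈ binaryWords (m + 1), f w
      = ∑ w ∈ binaryWords m, f (false :: w) + ∑ w ∈ binaryWords m, f (true :: w) := by
  rw [binaryWords, Finset.sum_union, Finset.sum_image, Finset.sum_image]
  · intro a _ b _ h; simpa using h
  · intro a _ b _ h; simpa using h
  · rw [Finset.disjoint_left]
    intro a h₁ h₂
    simp only [Finset.mem_image] at h₁ h₂
    obtain ⟨u, _, rfl⟩ := h₁
    obtain ⟨v, _, h⟩ := h₂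
    simp at h

theorem card_binaryWords (m : ℕ) : ((binaryWords m).card : ℝ) = 2 ^ m := by
  have h : ∀ m, ∑ _w ∈ binaryWords m, (1 : ℝ) = 2 ^ m := by
    intro m
    induction m with
    | zero => simp [binaryWords]
    | succ m ih => rw [sum_binaryWords_succ, ih, pow_succ]; ring
  simpa using h m

theorem kLength_append (k : ℕ) (σ τ : List Bool) :
    kLength k (σ ++ τ) = kLength k σ + kLength k τ := by
  simp only [kLength, List.count_append]
  ring

/-- The weight is multiplicative over letters: a 0 contributes x and a 1 contributes x^k. -/
theorem sum_pow_kLength_binaryWords (k m : ℕ) (x : ℝ) :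
    ∑ w ∈ binaryWords m, x ^ kLength k w = (x + x ^ k) ^ m := by
  induction m with
  | zero => simp [binaryWords, kLength]
  | succ m ih =>
    have h₀ : ∀ w, kLength k (false :: w) = 1 + kLength k w := fun w => by
      simp [kLength]; ring
    have h₁ : ∀ w, kLength k (true :: w) = k + kLength k w := fun w => by
      simp [kLength]; ring
    simp only [sum_binaryWords_succ, h₀, h₁, pow_add, ← Finset.mul_sum, ih]
    ring

/-- The converse of Kraft's inequality for finite sets. -/
theorem exists_prefix_code_of_kraft {ι : Type*} [DecidableEq ι] (S : Finset ι) (L : ι → ℕ)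
    (h : ∑ i ∈ S, (1 / 2 : ℝ) ^ L i ≤ 1) :
    ∃ c : ι → List Bool, (∀ i ∈ S, (c i).length = L i) ∧
      ∀ i ∈ S, ∀ j ∈ S, c i <+: c j → i = j := by
  -- Code words are chosen greedily in order of increasing length, so the new length is maximal.
  induction S using Finset.induction_on_max_value L with
  | empty => exact ⟨fun _ => [], by simp, by simp⟩
  | insert a s ha hmax ih =>
    rw [Finset.sum_insert ha] at h
    have hpos : (0 : ℝ) < (1 / 2) ^ L a := by positivity
    obtain ⟨c, hlen, hc⟩ := ih (by linarith)
    -- If every word of length `L a` extended an old code word, the old weights alone would sum to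
    -- at least 1, leaving no room for the weight of `a`.
    obtain ⟨v, hv, hvs⟩ : ∃ v ∈ binaryWords (L a), ∀ i ∈ s, ¬ c i <+: v := by
      by_contra! hcon
      have hsub : binaryWords (L a) ⊆
          s.biUnion fun i => (binaryWords (L a - L i)).image (c i ++ ·) := by
        intro v hv
        obtain ⟨i, hi, t, rfl⟩ := hcon v hv
        simp only [Finset.mem_biUnion, Finset.mem_image]
        refine ⟨i, hi, t, ?_, rfl⟩
        rw [mem_binaryWords] at hv ⊢
        rw [List.length_append, hlen i hi] at hv
        omega
      have hcard : ((binaryWords (L a)).card : ℝ) ≤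
          ∑ i ∈ s, ((binaryWords (L a - L i)).card : ℝ) := by
        refine le_trans (Nat.cast_le.2 ((Finset.card_le_card hsub).trans
          Finset.card_biUnion_le)) ?_
        push_cast
        exact Finset.sum_le_sum fun i _ => Nat.cast_le.2 Finset.card_image_le
      simp only [card_binaryWords] at hcard
      have hsum : ∑ i ∈ s, (2 : ℝ) ^ (L a - L i) = 2 ^ L a * ∑ i ∈ s, (1 / 2 : ℝ) ^ L i := by
        rw [Finset.mul_sum]
        refine Finset.sum_congr rfl fun i hi => ?_
        rw [pow_sub₀ _ two_ne_zero (hmax i hi), one_div, inv_pow]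
      rw [hsum] at hcard
      have h2 : (0 : ℝ) < 2 ^ L a := by positivity
      have := le_of_mul_le_mul_left ((mul_one _).trans_le hcard) h2
      linarith
    rw [mem_binaryWords] at hv
    refine ⟨Function.update c a v, ?_, ?_⟩
    · intro i hi
      rcases eq_or_ne i a with rfl | hne
      · simpa using hv
      · rw [Function.update_of_ne hne]
        exact hlen i (Finset.mem_of_mem_insert_of_ne hi hne)
    · intro i hi j hj hij
      rcases eq_or_ne i a with rfl | hia <;> rcases eq_or_ne j i with rfl | hji
      · rfl
      · have hj' := Finset.mem_of_mem_insert_of_ne hj hji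
        rw [Function.update_self, Function.update_of_ne hji] at hij
        have hle := hij.length_le
        rw [hv, hlen j hj'] at hle
        -- A prefix of an old code word that is at least as long equals it, which the choice of `v`
        -- excludes.
        have := hij.eq_of_length (by rw [hv, hlen j hj']; exact le_antisymm hle (hmax j hj'))
        exact absurd (this ▸ List.prefix_refl _) (hvs j hj')
      · rfl
      · have hi' := Finset.mem_of_mem_insert_of_ne hi hia
        rcases eq_or_ne j a with rfl | hja
        · rw [Function.update_self, Function.update_of_ne hia] at hij
          exact absurd hij (hvs i hi')
        · have hj' := Finset.mem_of_mem_insert_of_ne hj hja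
          rw [Function.update_of_ne hia, Function.update_of_ne hja] at hij
          exact hc i hi' j hj' hij

/-- Every function agrees on a given finite set with a primitive recursive one. -/
theorem exists_primrec_eqOn_finset {α β : Type*} [Primcodable α] [Primcodable β] [DecidableEq α]
    [Inhabited β] (S : Finset α) (c : α → β) : ∃ d : α → β, Primrec d ∧ ∀ a ∈ S, d a = c a := by
  induction S using Finset.induction_on with
  | empty => exact ⟨fun _ => default, Primrec.const _, by simp⟩
  | insert a s _ ih =>
    obtain ⟨d, hd, hdc⟩ := ih
    refine ⟨fun b => if b = a then c a else d b,
      Primrec.ite (Primrec.eq.comp Primrec.id (Primrec.const a)) (Primrec.const _) hd, ?_⟩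
    intro b hb
    by_cases h : b = a
    · simp [h]
    · simpa [h] using hdc b (Finset.mem_of_mem_insert_of_ne hb h)

/-! ### Block codes -/

/-- Encode a string by cutting it into blocks of length `m`, followed by a last, possibly empty,
block of length less than `m`, and concatenating the code words of the blocks under `c`. -/
def blockEncode (c : List Bool → List Bool) (m : ℕ) (τ : List Bool) : List Bool :=
  (List.range (τ.length / m + 1)).flatMap fun j => c ((τ.drop (m * j)).take m)

theorem primrec_blockEncode {c : List Bool → List Bool} (hc : Primrec c) (m : ℕ) :
    Primrec (blockEncode c m) := by
  unfold blockEncode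
  refine Primrec.list_flatMap (Primrec.list_range.comp (Primrec.succ.comp
    (Primrec.nat_div.comp Primrec.list_length (Primrec.const m)))) ?_
  exact (hc.comp (Primrec.list_take.comp (Primrec.const m) (Primrec.list_drop.comp
    (Primrec.nat_mul.comp (Primrec.const m) Primrec.snd) Primrec.fst))).to₂

theorem blockEncode_of_lt (c : List Bool → List Bool) {m : ℕ} {τ : List Bool}
    (h : τ.length < m) : blockEncode c m τ = c τ := by
  simp [blockEncode, Nat.div_eq_of_lt h, List.take_of_length_le h.le]

theorem blockEncode_of_le (c : List Bool → List Bool) {m : ℕ} (hm : 0 < m) {τ : List Bool}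
    (h : m ≤ τ.length) :
    blockEncode c m τ = c (τ.take m) ++ blockEncode c m (τ.drop m) := by
  have hdiv : τ.length / m = (τ.drop m).length / m + 1 := by
    rw [List.length_drop, Nat.div_eq_sub_div hm h]
  rw [blockEncode, hdiv, List.range_succ_eq_map, List.flatMap_cons, List.flatMap_map]
  simp [blockEncode, List.drop_drop, Nat.mul_succ, Nat.add_comm]

/-- The first code words of both encodings are prefixes of one string, hence comparable, so the
first blocks agree and can be cancelled. The short last block, coded even when empty, marks the end.
-/
theorem isPrefixCode_blockEncode {c : List Bool → List Bool} {m : ℕ} (hm : 0 < m)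
    (hc : ∀ σ τ, σ.length ≤ m → τ.length ≤ m → c σ <+: c τ → σ = τ) :
    IsPrefixCode (blockEncode c m) := by
  have hhead : ∀ τ, ∃ t, blockEncode c m τ = c (τ.take m) ++ t := by
    intro τ
    rcases lt_or_ge τ.length m with h | h
    · exact ⟨[], by rw [blockEncode_of_lt c h, List.take_of_length_le h.le, List.append_nil]⟩
    · exact ⟨_, blockEncode_of_le c hm h⟩
  have key : ∀ (n : ℕ) (σ τ : List Bool), σ.length ≤ n →
      blockEncode c m σ <+: blockEncode c m τ → σ = τ := by
    intro n
    induction n using Nat.strong_induction_on with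
    | _ n ih =>
      intro σ τ hσ h
      have htake : σ.take m = τ.take m := by
        obtain ⟨s, hs⟩ := hhead σ
        obtain ⟨t, ht⟩ := hhead τ
        have h₁ : c (σ.take m) <+: blockEncode c m τ :=
          (hs ▸ List.prefix_append _ _ : c (σ.take m) <+: blockEncode c m σ).trans h
        have h₂ : c (τ.take m) <+: blockEncode c m τ := ht ▸ List.prefix_append _ _
        rcases List.prefix_or_prefix_of_prefix h₁ h₂ with h' | h'
        · exact hc _ _ (List.length_take_le _ _) (List.length_take_le _ _) h'
        · exact (hc _ _ (List.length_take_le _ _) (List.length_take_le _ _) h').symm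
      have hlen := congrArg List.length htake
      rw [List.length_take, List.length_take] at hlen
      rcases lt_or_ge σ.length m with h' | h'
      · rwa [List.take_of_length_le h'.le, List.take_of_length_le (by omega)] at htake
      · have hτ : m ≤ τ.length := by omega
        rw [blockEncode_of_le c hm h', blockEncode_of_le c hm hτ, htake,
          List.prefix_append_right_inj] at h
        have hdrop := ih (n - m) (by omega) _ _ (by rw [List.length_drop]; omega) h
        rw [← List.take_append_drop m σ, htake, hdrop, List.take_append_drop]
  exact fun σ τ => key _ σ τ le_rfl

/-- Full blocks obey the bound with no additive error, so only the single last block costs a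
constant. -/
theorem length_blockEncode_le {c : List Bool → List Bool} {m k : ℕ} (hm : 0 < m) {a C : ℝ}
    (ha : 0 ≤ a) (hfull : ∀ w, w.length = m → ((c w).length : ℝ) ≤ a * kLength k w)
    (hlast : ∀ w, w.length < m → ((c w).length : ℝ) ≤ C) (τ : List Bool) :
    ((blockEncode c m τ).length : ℝ) ≤ a * kLength k τ + C := by
  induction hn : τ.length using Nat.strong_induction_on generalizing τ with
  | _ n ih =>
    rcases lt_or_ge τ.length m with h | h
    · rw [blockEncode_of_lt c h]
      have : 0 ≤ a * kLength k τ := by positivity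
      linarith [hlast τ h]
    · have h₁ := hfull (τ.take m) (by rw [List.length_take]; omega)
      have h₂ := ih (n - m) (by omega) (τ.drop m) (by rw [List.length_drop]; omega)
      have h₃ : (kLength k τ : ℝ) = kLength k (τ.take m) + kLength k (τ.drop m) := by
        rw [← Nat.cast_add, ← kLength_append, List.take_append_drop]
      rw [blockEncode_of_le c hm h, List.length_append, Nat.cast_add, h₃, mul_add]
      linarith

/-! ### Code lengths proportional to the `k`-length -/

theorem half_pow_floor_le (t : ℝ) : (1 / 2 : ℝ) ^ ⌊t⌋₊ ≤ 2 * (1 / 2 : ℝ) ^ t := by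
  have h : (1 / 2 : ℝ) ^ ((⌊t⌋₊ : ℝ) + 1) ≤ (1 / 2 : ℝ) ^ t :=
    Real.rpow_le_rpow_of_exponent_ge (by norm_num) (by norm_num) (Nat.lt_floor_add_one t).le
  rw [Real.rpow_add_one (by norm_num), Real.rpow_natCast] at h
  linarith

/-- If `x = 2 ^ (-a)` satisfies `x + x ^ k < 1`, then all binary strings have a computable prefix
code in which the code words are at most `a` times as long as the `k`-length, up to a constant. -/
theorem exists_prefixCode_length_le (k : ℕ) {a : ℝ} (ha : 0 ≤ a)
    (hx : (1 / 2 : ℝ) ^ a + ((1 / 2 : ℝ) ^ a) ^ k < 1) :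
    ∃ E : List Bool → List Bool, Computable E ∧ IsPrefixCode E ∧
      ∃ C : ℝ, ∀ τ, ((E τ).length : ℝ) ≤ a * kLength k τ + C := by
  set x : ℝ := (1 / 2 : ℝ) ^ a with hxdef
  have hx0 : 0 < x := Real.rpow_pos_of_pos (by norm_num) _
  -- Rounding at most doubles the weight of the full blocks, so 1/4 leaves them half of the Kraft
  -- sum. The fewer than 2^m shorter words, all given length `m + 1`, take the other half.
  obtain ⟨m, hm⟩ := exists_pow_lt_of_lt_one (show (0 : ℝ) < 1 / 4 by norm_num) hx
  have hm0 : 0 < m := by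
    rcases Nat.eq_zero_or_pos m with rfl | h
    · norm_num at hm
    · exact h
  let S : Finset (List Bool) := (Finset.range (m + 1)).biUnion binaryWords
  let L : List Bool → ℕ := fun w => if w.length = m then ⌊a * kLength k w⌋₊ else m + 1
  have hS : ∀ w, w ∈ S ↔ w.length ≤ m := by
    intro w
    simp [S, mem_binaryWords]
  have hkraft : ∑ w ∈ S, (1 / 2 : ℝ) ^ L w ≤ 1 := by
    rw [Finset.sum_biUnion, Finset.sum_range_succ]
    · have h₁ : ∑ w ∈ binaryWords m, (1 / 2 : ℝ) ^ L w ≤ 1 / 2 := by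
        calc ∑ w ∈ binaryWords m, (1 / 2 : ℝ) ^ L w
            ≤ ∑ w ∈ binaryWords m, 2 * x ^ kLength k w := by
              refine Finset.sum_le_sum fun w hw => ?_
              simp only [L, if_pos (mem_binaryWords.1 hw)]
              refine (half_pow_floor_le _).trans_eq ?_
              rw [Real.rpow_mul (by norm_num), Real.rpow_natCast]
          _ = 2 * (x + x ^ k) ^ m := by rw [← Finset.mul_sum, sum_pow_kLength_binaryWords]
          _ ≤ 1 / 2 := by linarith
      have h₂ : ∑ j ∈ Finset.range m, ∑ w ∈ binaryWords j, (1 / 2 : ℝ) ^ L w ≤ 1 / 2 := by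
        calc ∑ j ∈ Finset.range m, ∑ w ∈ binaryWords j, (1 / 2 : ℝ) ^ L w
            = ∑ j ∈ Finset.range m, (2 : ℝ) ^ j * (1 / 2) ^ (m + 1) := by
              refine Finset.sum_congr rfl fun j hj => ?_
              rw [← card_binaryWords, ← nsmul_eq_mul, ← Finset.sum_const]
              refine Finset.sum_congr rfl fun w hw => ?_
              have h := mem_binaryWords.1 hw
              have h' := Finset.mem_range.1 hj
              simp only [L, if_neg (show w.length ≠ m by omega)]
          _ = (2 ^ m - 1) * (1 / 2) ^ (m + 1) := by
              rw [← Finset.sum_mul, geom_sum_eq (by norm_num)]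
              norm_num
          _ ≤ 1 / 2 := by
              have h : (2 : ℝ) ^ m * (1 / 2) ^ m = 1 := by rw [← mul_pow]; norm_num
              have h' : (0 : ℝ) < (1 / 2) ^ m := by positivity
              rw [pow_succ]
              linarith
      linarith
    · intro i _ j _ hij
      rw [Function.onFun, Finset.disjoint_left]
      intro w hi hj
      exact hij ((mem_binaryWords.1 hi).symm.trans (mem_binaryWords.1 hj))
  obtain ⟨c', hlen, hpre⟩ := exists_prefix_code_of_kraft S L hkraft
  obtain ⟨c, hc, hcc⟩ := exists_primrec_eqOn_finset S c'
  refine ⟨blockEncode c m, (primrec_blockEncode hc m).to_comp, ?_, m + 1, ?_⟩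
  · refine isPrefixCode_blockEncode hm0 fun σ τ hσ hτ h => ?_
    rw [← hS] at hσ hτ
    rw [hcc σ hσ, hcc τ hτ] at h
    exact hpre σ hσ τ hτ h
  · refine length_blockEncode_le hm0 ha (fun w hw => ?_) fun w hw => ?_
    · rw [hcc w ((hS w).2 hw.le), hlen w ((hS w).2 hw.le)]
      simp only [L, if_pos hw]
      exact Nat.floor_le (by positivity)
    · rw [hcc w ((hS w).2 hw.le), hlen w ((hS w).2 hw.le)]
      simp [L, hw.ne]

/-! ### Decoding, and the comparison of K with K^(k) -/

/-- Composing a partial computable function with the decoder of a computable prefix code yields a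
prefix-free machine. -/
theorem exists_prefixFreeMachine_comp_prefixCode {E : List Bool → List Bool} (hE : Computable E)
    (hpre : IsPrefixCode E) {M : List Bool →. List Bool} (hM : Partrec M) :
    ∃ N : List Bool →. List Bool, IsPrefixFreeMachine N ∧ ∀ τ, N (E τ) = M τ := by
  let f : List Bool → ℕ → Option (List Bool) := fun σ n =>
    (Encodable.decode (α := List Bool) n).bind fun τ => if E τ = σ then some τ else none
  have hf : Computable₂ f := by
    refine Computable.option_bind (Computable.decode.comp Computable.snd) ?_
    have hite : Primrec fun q : (List Bool × List Bool) × List Bool =>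
        if q.1.1 = q.1.2 then some q.2 else none :=
      Primrec.ite (Primrec.eq.comp (Primrec.fst.comp Primrec.fst) (Primrec.snd.comp Primrec.fst))
        (Primrec.option_some.comp Primrec.snd) (Primrec.const none)
    exact (hite.to_comp.comp (((hE.comp Computable.snd).pair
      (Computable.fst.comp Computable.fst)).pair Computable.snd)).to₂
  have hfmem : ∀ σ n τ, τ ∈ f σ n → E τ = σ := by
    intro σ n τ h
    simp only [f, Option.mem_def, Option.bind_eq_some_iff] at h
    obtain ⟨τ', _, h⟩ := h
    split_ifs at h with h'
    rw [← Option.some.inj h, h']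
  -- The decoder searches all strings for a preimage under `E`, which is unique because a prefix
  -- code is injective.
  let D : List Bool →. List Bool := fun σ => Nat.rfindOpt (f σ)
  have hDmem : ∀ σ τ, τ ∈ D σ → E τ = σ := fun σ τ h =>
    let ⟨n, hn⟩ := Nat.rfindOpt_spec h
    hfmem σ n τ hn
  have hDE : ∀ τ, D (E τ) = Part.some τ := by
    intro τ
    have hdom : (D (E τ)).Dom :=
      Nat.rfindOpt_dom.2 ⟨Encodable.encode τ, τ, by simp [f]⟩
    have hget := hDmem _ _ (Part.get_mem hdom)
    have : (D (E τ)).get hdom = τ := hpre _ _ (by rw [hget])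
    have hmem := Part.get_mem hdom
    rw [this] at hmem
    exact Part.eq_some_iff.2 hmem
  have hdomE : ∀ σ ∈ PFun.Dom (fun σ => (D σ).bind M), ∃ τ, E τ = σ := by
    intro σ hσ
    obtain ⟨y, hy⟩ := Part.dom_iff_mem.1 hσ
    obtain ⟨τ, hτ, _⟩ := Part.mem_bind_iff.1 hy
    exact ⟨τ, hDmem σ τ hτ⟩
  refine ⟨fun σ => (D σ).bind M, ⟨?_, ?_⟩, fun τ => ?_⟩
  · exact (Partrec.rfindOpt hf).bind (hM.comp Computable.snd).to₂
  · intro σ₁ h₁ σ₂ h₂ h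
    obtain ⟨τ₁, rfl⟩ := hdomE σ₁ h₁
    obtain ⟨τ₂, rfl⟩ := hdomE σ₂ h₂
    rw [hpre τ₁ τ₂ h]
  · simp only [hDE]
    exact Part.bind_some τ M

theorem lengthComplexity_le {ℓ : List Bool → ℕ} {M : List Bool →. List Bool} {σ τ : List Bool}
    (h : σ ∈ M τ) : lengthComplexity ℓ M σ ≤ ℓ τ :=
  Nat.sInf_le ⟨τ, h, rfl⟩

theorem IsUniversalPrefixFreeMachine.exists_kComplexity_eq {U : List Bool →. List Bool}
    (hU : IsUniversalPrefixFreeMachine U) (k : ℕ) (σ : List Bool) :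
    ∃ τ, σ ∈ U τ ∧ kLength k τ = kComplexity k U σ := by
  obtain ⟨τ, hτ⟩ := hU.exists_description σ
  exact Nat.sInf_mem (s := {m | ∃ τ, σ ∈ U τ ∧ kLength k τ = m}) ⟨_, τ, hτ, rfl⟩

/-- A comparison of `K` with `K^(k)`: if `x = 2 ^ (-a)` satisfies `x + x ^ k < 1`, then
`K ≤ a K^(k) + O(1)`. -/
theorem IsUniversalPrefixFreeMachine.exists_kolmogorov_le {U : List Bool →. List Bool}
    (hU : IsUniversalPrefixFreeMachine U) (k : ℕ) {a : ℝ} (ha : 0 ≤ a)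
    (hx : (1 / 2 : ℝ) ^ a + ((1 / 2 : ℝ) ^ a) ^ k < 1) :
    ∃ C : ℝ, ∀ σ, (kolmogorov U σ : ℝ) ≤ a * kComplexity k U σ + C := by
  obtain ⟨E, hE, hpre, C, hC⟩ := exists_prefixCode_length_le k ha hx
  obtain ⟨N, hN, hNE⟩ := exists_prefixFreeMachine_comp_prefixCode hE hpre hU.1.1
  obtain ⟨ρ, hρ⟩ := hU.2 N hN
  refine ⟨ρ.length + C, fun σ => ?_⟩
  obtain ⟨τ, hτ, hk⟩ := hU.exists_kComplexity_eq k σ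
  have hmem : σ ∈ N (E τ) := (hNE τ).symm ▸ hτ
  rw [← hρ (E τ) (Part.dom_iff_mem.2 ⟨σ, hmem⟩)] at hmem
  have h : (kolmogorov U σ : ℝ) ≤ ((ρ ++ E τ).length : ℝ) :=
    Nat.cast_le.2 (lengthComplexity_le hmem)
  rw [List.length_append, Nat.cast_add] at h
  rw [← hk]
  linarith [hC τ]

/-! ### The root p_k and entropy -/

theorem pRoot_mem_Ioo (k : ℕ) (hk : 1 ≤ k) : pRoot k hk ∈ Set.Ioo (0 : ℝ) 1 :=
  (existsUnique_pRoot k hk).choose_spec.1.1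

theorem pRoot_pow (k : ℕ) (hk : 1 ≤ k) : pRoot k hk ^ k = 1 - pRoot k hk := by
  have h : pRoot k hk ^ k + pRoot k hk - 1 = 0 := (existsUnique_pRoot k hk).choose_spec.1.2
  linarith

/-- The entropy of the Bernoulli distribution with parameter `p_k` is at most one bit. -/
theorem neg_log_two_le_mul_log_pRoot (k : ℕ) (hk : 1 ≤ k) :
    -Real.log 2 ≤ (1 + ((k : ℝ) - 1) * (1 - pRoot k hk)) * Real.log (pRoot k hk) := by
  have h := Real.binEntropy_le_log_two (p := pRoot k hk)
  -- Since 1 - p = p^k, log(1 - p) = k log p, so the entropy is a multiple of log p.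
  rw [Real.binEntropy, Real.log_inv, Real.log_inv, ← pRoot_pow k hk, Real.log_pow,
    pRoot_pow k hk] at h
  linarith

theorem half_rpow_lt_pRoot {k : ℕ} (hk : 1 ≤ k) {d : ℝ} (hd : 0 < d)
    (hlt : d < 1 + ((k : ℝ) - 1) * (1 - pRoot k hk)) : (1 / 2 : ℝ) ^ (1 / d) < pRoot k hk := by
  obtain ⟨hp0, hp1⟩ := pRoot_mem_Ioo k hk
  have h := neg_log_two_le_mul_log_pRoot k hk
  have hlog : Real.log (pRoot k hk) < 0 := Real.log_neg hp0 hp1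
  have h' := mul_lt_mul_of_neg_right hlt hlog
  rw [← Real.log_lt_log_iff (Real.rpow_pos_of_pos (by norm_num) _) hp0,
    Real.log_rpow (by norm_num), one_div (2 : ℝ), Real.log_inv, one_div_mul_eq_div, div_lt_iff₀ hd]
  linarith

theorem mainTheorem8 (U : List Bool →. List Bool) (hU : IsUniversalPrefixFreeMachine U)
    (k : ℕ) (hk : 1 ≤ k) (ε : ℝ) (hε : ε ∈ Set.Ioo (0 : ℝ) (1 - pRoot k hk))
    (X : ℕ → Bool)
    (hX : ∃ c : ℝ, ∀ n : ℕ,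
      (n : ℝ) / (1 + ((k : ℝ) - 1) * (1 - pRoot k hk - ε)) - c
        ≤ (kolmogorov U (initSeg X n) : ℝ)) :
    IsKJIncompressible U k 1 X := by
  obtain ⟨c, hc⟩ := hX
  obtain ⟨hε0, hε1⟩ := hε
  set d : ℝ := 1 + ((k : ℝ) - 1) * (1 - pRoot k hk - ε) with hd
  -- For k = 1 the gain from ε vanishes, but d = 1 and K^(1) = K, so the hypothesis is already the
  -- conclusion.
  rcases hk.eq_or_lt with rfl | hk1
  · refine ⟨c, fun n => ?_⟩
    have hK : kComplexity 1 U = kolmogorov U := by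
      have : kLength 1 = List.length := by
        funext τ
        simp [kLength]
      unfold kComplexity kolmogorov
      rw [this]
    rw [kLength_one_initSeg, hK]
    simpa [hd] using hc n
  · have hk' : (0 : ℝ) < (k : ℝ) - 1 := sub_pos.2 (by exact_mod_cast hk1)
    have hd0 : 0 < d := by
      have := mul_pos hk' (sub_pos.2 hε1)
      linarith
    have hx : (1 / 2 : ℝ) ^ (1 / d) < pRoot k hk :=
      half_rpow_lt_pRoot hk hd0 (by have := mul_pos hk' hε0; rw [hd]; linarith)
    -- From x < p follows x^k ≤ p^k = 1 - p, hence x + x^k < 1.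
    have hxk := pow_le_pow_left₀ (Real.rpow_nonneg (by norm_num) _) hx.le k
    rw [pRoot_pow] at hxk
    obtain ⟨C, hC⟩ := hU.exists_kolmogorov_le k (one_div_pos.2 hd0).le (by linarith)
    refine ⟨(c + C) * d, fun n => ?_⟩
    rw [kLength_one_initSeg]
    have h : (n : ℝ) / d - kComplexity k U (initSeg X n) / d ≤ c + C := by
      have := (hc n).trans (hC _)
      rw [one_div_mul_eq_div] at this
      linarith
    rw [← sub_div, div_le_iff₀ hd0] at h
    linarith
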